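/- **Setting.** A graph $\mathbf G$ on $N$ nodes is given by a real symmetric $N\times N$ shift matrix $\mathbf S$ (edge weights); a graph signal is a pair $(\mathbf G,\mathbf x)$ with $\mathbf x\in\mathbb R^{N}$. A graphon is a bounded symmetric measurable function $\mathbf W:[0,1]^2\to\mathbb R$, and a graphon signal is a pair $(\mathbf W,\phi)$ with $\phi\in L^2([0,1])$. Let $(T_{\mathbf W}f)(u)=\int_0^1\mathbf W(u,v)f(v)\,dv$ on $L^2([0,1])$. The graphon $\mathbf W$ is *non-derogatory* if the nonzero eigenvalues of $T_{\mathbf W}$, listed with multiplicity, are pairwise distinct. With $I_1,\dots,I_N$ the partition of $[0,1]$ into $N$ consecutive intervals of length $1/N$, $(\mathbf G,\mathbf x)$ induces $\mathbf W_{\mathbf G}(u,v)=\sum_{j,k}\mathbf S_{jk}\mathbb 1(u\in I_j)\mathbb 1(v\in I_k)$ and $\phi_{\mathbf x}(u)=\sum_k \mathbf x_k\mathbb 1(u\in I_k)$. *Convergence.* $\{(\mathbf G_n,\mathbf x_n)\}$ converges to $(\mathbf W,\phi)$ if $t(F,\mathbf G_n)\to t(F,\mathbf W)$ for the homomorphism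 density $t(F,\cdot)$ of every finite simple graph $F$, and there are node permutations $\pi_n$ such that $\mathbf W_{\pi_n(\mathbf G_n)}\to\mathbf W$ in cut norm and $\phi_{\pi_n(\mathbf x_n)}\to\phi$ in $L^2([0,1])$. **Theorem (Convergence of filter response for Lipschitz continuous graph filters).** Let $\mathbf G_n$ be graphs on $N_n$ nodes with shift matrices $\mathbf S_n=\mathbf V_n\boldsymbol\Lambda(\mathbf S_n)\mathbf V_n^{\mathsf H}$ ($\mathbf V_n$ unitary, $\boldsymbol\Lambda(\mathbf S_n)$ diagonal) whose entries are bounded in absolute value by a constant $M$ not depending on $n$ ($M=1$ for weights in $[0,1]$). Let $\mathbf W$ be a non-derogatory graphon, let $\phi\in L^2([0,1])$, and let $h:[-M,M]\to\mathbb R$ be $L$-Lipschitz. Let $\{\varphi_i\}$ be any orthonormal basis of $L^2([0,1])$ consisting of eigenfunctions of $T_{\mathbf W}$, $T_{\mathbf W}\varphi_i=\lambda_i\varphi_i$ (eigenvalue $0$ included), and $\hat\phi(\lambda_i)=\int_0^1\phi\,\varphi_i$. Put $$\mathbf y_n=\mathbf V_n\,h\big(\boldsymbol\Lambda(\mathbf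 S_n)/N_n\big)\,\mathbf V_n^{\mathsf H}\,\mathbf x_n,\qquad \gamma=T_{\mathbf H}\phi=\sum_i h(\lambda_i)\,\hat\phi(\lambda_i)\,\varphi_i .$$ If $\{(\mathbf G_n,\mathbf x_n)\}$ converges to $(\mathbf W,\phi)$, then the series defining $\gamma$ converges unconditionally in $L^2([0,1])$ and $\{(\mathbf G_n,\mathbf y_n)\}$ converges to $(\mathbf W,\gamma)$. -/

import Mathlib

open MeasureTheory Filter Topology Matrix
open scoped unitInterval NNReal

noncomputable section

/-- Finite-energy functions on `[0,1]`. -/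
abbrev L2I : Type := Lp ℝ 2 (volume : Measure I)

/-! ### Weighted graphs, graph signals and graph filters -/

/-- An undirected graph on `n` nodes with real edge weights, given by its symmetric
graph shift operator (weighted adjacency matrix). -/
structure WGraph (n : ℕ) where
  shift : Matrix (Fin n) (Fin n) ℝ
  symm : shift.IsHermitian

/-- Relabelling of the nodes of a graph. -/
def WGraph.permute {n : ℕ} (G : WGraph n) (π : Equiv.Perm (Fin n)) : WGraph n where
  shift := G.shift.submatrix π π
  symm := G.symm.submatrix π

/-- The graph filter `V h(Λ / n) Vᴴ`, where `V Λ Vᴴ` is the spectral decomposition of the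
shift operator of `G`. -/
def WGraph.filter {n : ℕ} (G : WGraph n) (h : ℝ → ℝ) : Matrix (Fin n) (Fin n) ℝ :=
  (G.symm.eigenvectorUnitary : Matrix (Fin n) (Fin n) ℝ)
    * Matrix.diagonal (fun j => h (G.symm.eigenvalues j / n))
    * (G.symm.eigenvectorUnitary : Matrix (Fin n) (Fin n) ℝ)ᴴ

/-- The homomorphism density `t(F, G)` of a motif `F` (a finite simple graph) in `G`. -/
def WGraph.homDensity {n k : ℕ} (F : SimpleGraph (Fin k)) (G : WGraph n) : ℝ := by
  classical
  exact (∑ β : Fin k → Fin n,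
    ∏ e : Fin k × Fin k with e.1 < e.2 ∧ F.Adj e.1 e.2, G.shift (β e.1) (β e.2)) / (n : ℝ) ^ k

/-! ### Graphons -/

/-- A graphon: a bounded symmetric measurable function on `[0,1]²`. -/
structure Graphon where
  toFun : I → I → ℝ
  measurable' : Measurable (Function.uncurry toFun)
  symm' : ∀ u v, toFun u v = toFun v u
  bounded' : ∃ C : ℝ, ∀ u v, |toFun u v| ≤ C

instance : CoeFun Graphon (fun _ => I → I → ℝ) := ⟨Graphon.toFun⟩

/-- The homomorphism density `t(F, W)` of a motif `F` in a graphon. -/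
def Graphon.homDensity {k : ℕ} (F : SimpleGraph (Fin k)) (W : Graphon) : ℝ := by
  classical
  exact ∫ x : Fin k → I,
    ∏ e : Fin k × Fin k with e.1 < e.2 ∧ F.Adj e.1 e.2, W (x e.1) (x e.2)

/-- The cut norm of a kernel on `[0,1]²`. -/
def cutNorm (K : I → I → ℝ) : ℝ :=
  ⨆ p : {A : Set I // MeasurableSet A} × {B : Set I // MeasurableSet B},
    |∫ u in p.1.1, ∫ v in p.2.1, K u v|

/-- The cell `[k/n, (k+1)/n)` of the regular partition of `[0,1]` into `n` intervals; the last
cell is closed. -/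
def cell (n : ℕ) (k : Fin n) : Set I :=
  {u | (k : ℝ) / n ≤ u ∧ ((u : ℝ) < ((k : ℝ) + 1) / n ∨ (k : ℕ) + 1 = n)}

lemma measurableSet_cell (n : ℕ) (k : Fin n) : MeasurableSet (cell n k) := by
  unfold cell
  refine MeasurableSet.inter ?_ (MeasurableSet.union ?_ (MeasurableSet.const _))
  · exact measurableSet_le measurable_const measurable_subtype_coe
  · exact measurableSet_lt measurable_subtype_coe measurable_const

/-- The step function on `[0,1]` induced by a graph signal. -/
def stepSignal {n : ℕ} (x : Fin n → ℝ) (u : I) : ℝ :=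
  ∑ k, x k * (cell n k).indicator 1 u

lemma memLp_stepSignal {n : ℕ} (x : Fin n → ℝ) : MemLp (stepSignal x) 2 (volume : Measure I) := by
  unfold stepSignal
  refine memLp_finsetSum _ fun k _ => MemLp.const_mul ?_ _
  exact (memLp_const (1 : ℝ)).indicator (measurableSet_cell n k)

/-- The graphon signal induced by a graph signal, as an element of `L²([0,1])`. -/
def inducedSignal {n : ℕ} (x : Fin n → ℝ) : L2I := (memLp_stepSignal x).toLp

/-- The graphon induced by a graph: a step function on the regular partition. -/
def WGraph.induced {n : ℕ} (G : WGraph n) : Graphon where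
  toFun u v := ∑ j, ∑ k, G.shift j k * (cell n j).indicator 1 u * (cell n k).indicator 1 v
  measurable' := by
    refine Finset.measurable_sum _ fun j _ => Finset.measurable_sum _ fun k _ => ?_
    refine Measurable.mul (Measurable.mul measurable_const ?_) ?_
    · exact (measurable_one.indicator (measurableSet_cell n j)).comp measurable_fst
    · exact (measurable_one.indicator (measurableSet_cell n k)).comp measurable_snd
  symm' u v := by
    rw [Finset.sum_comm]
    refine Finset.sum_congr rfl fun k _ => Finset.sum_congr rfl fun j _ => ?_
    have := G.symm.apply j k
    simp only [star_trivial] at this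
    rw [this]; ring
  bounded' := by
    refine ⟨∑ j, ∑ k, |G.shift j k|, fun u v => ?_⟩
    refine (Finset.abs_sum_le_sum_abs _ _).trans (Finset.sum_le_sum fun j _ => ?_)
    refine (Finset.abs_sum_le_sum_abs _ _).trans (Finset.sum_le_sum fun k _ => ?_)
    rw [abs_mul, abs_mul]
    have h1 : ∀ (i : Fin n) (w : I), |(cell n i).indicator (1 : I → ℝ) w| ≤ 1 := by
      intro i w
      by_cases hw : w ∈ cell n i <;> simp [hw]
    calc _ ≤ |G.shift j k| * 1 * 1 := by gcongr <;> apply h1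
      _ = _ := by ring

/-! ### The integral operator of a graphon -/

namespace Graphon

variable (W : Graphon)

lemma measurable_section (u : I) : Measurable (W u) :=
  W.measurable'.comp measurable_prodMk_left

lemma memLp_section (u : I) : MemLp (W u) 2 (volume : Measure I) := by
  obtain ⟨C, hC⟩ := W.bounded'
  exact MemLp.of_bound (W.measurable_section u).aestronglyMeasurable C
    (Eventually.of_forall fun v => hC u v)

lemma norm_section_le {C : ℝ} (hC : ∀ u v, |W u v| ≤ C) (u : I) :
    ‖(W.memLp_section u).toLp‖ ≤ C := by
  have h0 : 0 ≤ C := (abs_nonneg _).trans (hC 0 0)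
  have := Lp.norm_le_of_ae_bound (p := 2) (μ := (volume : Measure I))
    (f := (W.memLp_section u).toLp) h0 (by
      filter_upwards [(W.memLp_section u).coeFn_toLp] with v hv
      rw [hv]; exact hC u v)
  simpa [measureUnivNNReal] using this

/-- `(T_W f)(u) = ∫ W(u,v) f(v) dv`. -/
def opFun (f : L2I) (u : I) : ℝ := ∫ v, W u v * f v

lemma opFun_eq_inner (f : L2I) (u : I) :
    W.opFun f u = inner ℝ (W.memLp_section u).toLp f := by
  rw [L2.inner_def]
  refine integral_congr_ae ?_
  filter_upwards [(W.memLp_section u).coeFn_toLp] with v hv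
  simp [hv, mul_comm]

lemma abs_opFun_le {C : ℝ} (hC : ∀ u v, |W u v| ≤ C) (f : L2I) (u : I) :
    |W.opFun f u| ≤ C * ‖f‖ := by
  rw [opFun_eq_inner]
  exact (abs_real_inner_le_norm _ _).trans (by gcongr; exact W.norm_section_le hC u)

lemma stronglyMeasurable_opFun (f : L2I) : StronglyMeasurable (W.opFun f) := by
  have h : StronglyMeasurable (fun p : I × I => W p.1 p.2 * f p.2) :=
    W.measurable'.stronglyMeasurable.mul ((Lp.stronglyMeasurable f).comp_measurable measurable_snd)
  exact h.integral_prod_right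

lemma memLp_opFun (f : L2I) : MemLp (W.opFun f) 2 (volume : Measure I) := by
  obtain ⟨C, hC⟩ := W.bounded'
  exact MemLp.of_bound (W.stronglyMeasurable_opFun f).aestronglyMeasurable (C * ‖f‖)
    (Eventually.of_forall fun u => W.abs_opFun_le hC f u)

/-- The integral operator `T_W` on `L²([0,1])`. -/
def op : L2I →L[ℝ] L2I :=
  LinearMap.mkContinuousOfExistsBound
    { toFun := fun f => (W.memLp_opFun f).toLp
      map_add' := fun f g => by
        rw [← MemLp.toLp_add]
        refine MemLp.toLp_congr _ _ (Eventually.of_forall fun u => ?_)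
        simp only [Pi.add_apply, opFun_eq_inner, inner_add_right]
      map_smul' := fun c f => by
        rw [RingHom.id_apply, ← MemLp.toLp_const_smul]
        refine MemLp.toLp_congr _ _ (Eventually.of_forall fun u => ?_)
        simp only [Pi.smul_apply, opFun_eq_inner, inner_smul_right, smul_eq_mul] }
    (by
      obtain ⟨C, hC⟩ := W.bounded'
      refine ⟨C, fun f => ?_⟩
      have h0 : 0 ≤ C := (abs_nonneg _).trans (hC 0 0)
      have := Lp.norm_le_of_ae_bound (p := 2) (μ := (volume : Measure I))
        (f := (W.memLp_opFun f).toLp) (mul_nonneg h0 (norm_nonneg f)) (by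
          filter_upwards [(W.memLp_opFun f).coeFn_toLp] with v hv
          rw [hv]; exact W.abs_opFun_le hC f v)
      simpa [measureUnivNNReal] using this)

/-- Every nonzero eigenvalue of `T_W` is simple: listing the nonzero eigenvalues with
multiplicity, no two coincide. -/
def NonDerogatory : Prop :=
  ∀ μ : ℝ, μ ≠ 0 → Module.rank ℝ (Module.End.eigenspace (W.op : L2I →ₗ[ℝ] L2I) μ) ≤ 1

/-- A complete orthonormal system `φ_i` of eigenfunctions of `T_W` (those of eigenvalue `0`
included) with its eigenvalues `λ_i`. -/
structure Eigenbasis (ι : Type*) where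
  basis : HilbertBasis ι ℝ L2I
  eigenvalue : ι → ℝ
  op_basis : ∀ i, W.op (basis i) = eigenvalue i • basis i

variable {W} {ι : Type*}

/-- The graphon Fourier coefficient of `φ`: its inner product with the `i`-th eigenfunction. -/
def Eigenbasis.wft (E : W.Eigenbasis ι) (φ : L2I) (i : ι) : ℝ := ∫ v, φ v * E.basis i v

/-- The `i`-th term of the graphon filter with filter function `h` applied to `φ`. -/
def Eigenbasis.filterTerm (E : W.Eigenbasis ι) (h : ℝ → ℝ) (φ : L2I) (i : ι) : L2I :=
  (h (E.eigenvalue i) * E.wft φ i) • E.basis i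

/-- The output `∑ᵢ h(λᵢ) φ̂(λᵢ) φᵢ` of the graphon filter with filter function `h`. -/
def Eigenbasis.filter (E : W.Eigenbasis ι) (h : ℝ → ℝ) (φ : L2I) : L2I :=
  ∑' i, E.filterTerm h φ i

end Graphon

/-! ### Existence of the eigenfunction system -/

lemma exists_hilbertBasis_eigenvectors {E : Type} [NormedAddCommGroup E] [InnerProductSpace ℝ E]
    [CompleteSpace E] (T : E →L[ℝ] E) (hT : IsCompactOperator T)
    (hT' : (T : E →ₗ[ℝ] E).IsSymmetric) :
    ∃ (ι : Type) (B : HilbertBasis ι ℝ E) (μ : ι → ℝ), ∀ i, T (B i) = μ i • B i := by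
  let V : ℝ → Submodule ℝ E := fun μ => Module.End.eigenspace (T : E →ₗ[ℝ] E) μ
  have hmem : ∀ μ f, f ∈ V μ ↔ T f = μ • f := fun μ f => Module.End.mem_eigenspace_iff
  have hclosed : ∀ μ, IsClosed (V μ : Set E) := by
    intro μ
    have : (V μ : Set E) = {f | T f = μ • f} := Set.ext fun f => hmem μ f
    rw [this]
    exact isClosed_eq T.continuous (continuous_const_smul μ)
  have hcomplete : ∀ μ, CompleteSpace (V μ) := fun μ => (hclosed μ).completeSpace_coe
  choose w b hb using fun μ => exists_hilbertBasis ℝ (V μ)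
  let v : (Σ μ, w μ) → E := fun a => (b a.1 a.2 : E)
  have hv : Orthonormal ℝ v :=
    hT'.orthogonalFamily_eigenspaces.orthonormal_sigma_orthonormal (fun μ => (b μ).orthonormal)
  have hsp : (Submodule.span ℝ (Set.range v))ᗮ = ⊥ := by
    rw [eq_bot_iff, ← T.orthogonalComplement_iSup_eigenspaces_eq_bot hT hT']
    intro f hf
    rw [← Submodule.iInf_orthogonal, Submodule.mem_iInf]
    intro μ
    rw [Submodule.mem_orthogonal']
    intro g hg
    have hs := (b μ).hasSum_repr ⟨g, hg⟩
    have hs2 := (hs.mapL (V μ).subtypeL).mapL (innerSL ℝ f)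
    refine hs2.unique ?_
    convert! hasSum_zero using 1
    ext i
    have hi : inner ℝ f (b μ i : E) = 0 :=
      (Submodule.mem_orthogonal' _ _).1 hf _ (Submodule.subset_span ⟨⟨μ, i⟩, rfl⟩)
    simp [hi]
  refine ⟨Σ μ, w μ, HilbertBasis.mkOfOrthogonalEqBot hv hsp, fun a => a.1, fun a => ?_⟩
  rw [HilbertBasis.coe_mkOfOrthogonalEqBot]
  exact (hmem a.1 _).1 (b a.1 a.2).2

namespace Graphon

variable (W : Graphon)

lemma op_coeFn (f : L2I) : W.op f =ᵐ[volume] W.opFun f := (W.memLp_opFun f).coeFn_toLp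

lemma op_isSymmetric : (W.op : L2I →ₗ[ℝ] L2I).IsSymmetric := by
  intro f g
  obtain ⟨C, hC⟩ := W.bounded'
  have e1 : inner ℝ (W.op f) g = ∫ u, ∫ v, W u v * f v * g u := by
    rw [L2.inner_def]
    refine integral_congr_ae ?_
    filter_upwards [W.op_coeFn f] with u hu
    rw [hu]
    simp only [opFun, RCLike.inner_apply, conj_trivial]
    rw [← integral_const_mul]
    exact integral_congr_ae (Eventually.of_forall fun v => by ring)
  have e2 : inner ℝ f (W.op g) = ∫ u, ∫ v, W u v * f u * g v := by
    rw [L2.inner_def]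
    refine integral_congr_ae ?_
    filter_upwards [W.op_coeFn g] with u hu
    rw [hu]
    simp only [opFun, RCLike.inner_apply, conj_trivial]
    rw [← integral_mul_const]
    exact integral_congr_ae (Eventually.of_forall fun v => by ring)
  have hf : Integrable f (volume : Measure I) := (Lp.memLp f).integrable (by norm_num)
  have hg : Integrable g (volume : Measure I) := (Lp.memLp g).integrable (by norm_num)
  change inner ℝ (W.op f) g = inner ℝ f (W.op g)
  rw [e1, e2, integral_integral_swap]
  · refine integral_congr_ae (Eventually.of_forall fun u =>
      integral_congr_ae (Eventually.of_forall fun v => ?_))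
    simp only [W.symm' v u]
  · have h := (hg.mul_prod hf).bdd_mul (f := fun p : I × I => W p.1 p.2) (c := C)
      W.measurable'.aestronglyMeasurable (Eventually.of_forall fun p => hC p.1 p.2)
    refine h.congr (Eventually.of_forall fun p => ?_)
    simp only [Function.uncurry]; ring

lemma exists_countable_hilbertBasis :
    ∃ (ι : Type) (_ : Countable ι), Nonempty (HilbertBasis ι ℝ L2I) := by
  obtain ⟨w, b, hb⟩ := exists_hilbertBasis ℝ L2I
  refine ⟨w, ?_, ⟨b⟩⟩
  have hd : Set.PairwiseDisjoint (Set.univ : Set w) (fun i => Metric.ball (b i) (1 / 2)) := by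
    intro i _ j _ hij
    refine Metric.ball_disjoint_ball ?_
    have h1 : ‖b i - b j‖ ^ 2 = 2 := by
      rw [norm_sub_sq_real, b.orthonormal.1, b.orthonormal.1, b.orthonormal.2 hij]; norm_num
    rw [dist_eq_norm]
    nlinarith [norm_nonneg (b i - b j)]
  have : Fact ((2 : ENNReal) ≠ ⊤) := ⟨by norm_num⟩
  have : SecondCountableTopology L2I := Lp.SecondCountableTopology
  have := hd.countable_of_isOpen (fun i _ => Metric.isOpen_ball)
    (fun i _ => ⟨b i, Metric.mem_ball_self (by norm_num)⟩)
  exact Set.countable_univ_iff.mp this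

lemma op_isCompact : IsCompactOperator W.op := by
  obtain ⟨C, hC⟩ := W.bounded'
  have hC0 : 0 ≤ C := (abs_nonneg _).trans (hC 0 0)
  obtain ⟨ι, _, ⟨b⟩⟩ := exists_countable_hilbertBasis
  let K : I → L2I := fun u => (W.memLp_section u).toLp
  let P : Finset ι → L2I →L[ℝ] L2I := fun s => ∑ i ∈ s, (innerSL ℝ (b i)).smulRight (b i)
  have hP : ∀ s f, P s f = ∑ i ∈ s, inner ℝ (b i) f • b i := fun s f => by simp [P]
  -- the squared distance of the section at `u` from the span of the `b i`, `i ∈ s`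
  let R : Finset ι → I → ℝ := fun s u => ‖K u‖ ^ 2 - ∑ i ∈ s, (W.opFun (b i) u) ^ 2
  have hR : ∀ s u, ‖K u - P s (K u)‖ ^ 2 = R s u := by
    intro s u
    have h2 : inner ℝ (K u) (P s (K u)) = ∑ i ∈ s, (W.opFun (b i) u) ^ 2 := by
      rw [hP, inner_sum]
      refine Finset.sum_congr rfl fun i _ => ?_
      rw [inner_smul_right, opFun_eq_inner, real_inner_comm (K u) (b i)]
      simp only [K]; ring
    have h3 : ‖P s (K u)‖ ^ 2 = ∑ i ∈ s, (W.opFun (b i) u) ^ 2 := by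
      rw [← real_inner_self_eq_norm_sq, hP, b.orthonormal.inner_sum]
      refine Finset.sum_congr rfl fun i _ => ?_
      rw [opFun_eq_inner, real_inner_comm (K u) (b i)]
      simp only [K, conj_trivial]; ring
    rw [norm_sub_sq_real, h2, h3]; simp only [R]; ring
  have hK : ∀ u, ‖K u‖ ≤ C := W.norm_section_le hC
  have hKm : StronglyMeasurable fun u => ‖K u‖ ^ 2 := by
    have : ∀ u, ‖K u‖ ^ 2 = ∫ v, W u v * W u v := by
      intro u
      rw [← real_inner_self_eq_norm_sq, L2.inner_def]
      refine integral_congr_ae ?_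
      filter_upwards [(W.memLp_section u).coeFn_toLp] with v hv
      simp [K, hv, sq]
    simp_rw [this]
    have h : StronglyMeasurable (fun p : I × I => W p.1 p.2 * W p.1 p.2) :=
      (W.measurable'.mul W.measurable').stronglyMeasurable
    exact h.integral_prod_right
  have hRm : ∀ s, StronglyMeasurable (R s) := fun s =>
    hKm.sub (Finset.stronglyMeasurable_fun_sum s fun i _ => (W.stronglyMeasurable_opFun (b i)).pow 2)
  have hRb : ∀ s u, ‖R s u‖ ≤ C ^ 2 := by
    intro s u
    have h0 : 0 ≤ R s u := by rw [← hR]; positivity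
    have h1 : 0 ≤ ∑ i ∈ s, (W.opFun (b i) u) ^ 2 := Finset.sum_nonneg fun i _ => sq_nonneg _
    rw [Real.norm_of_nonneg h0]
    have : ‖K u‖ ^ 2 ≤ C ^ 2 := by gcongr; exact hK u
    simp only [R]; linarith
  have hRi : ∀ s, Integrable (R s) := fun s =>
    (integrable_const (C ^ 2)).mono' (hRm s).aestronglyMeasurable
      (Eventually.of_forall (hRb s))
  have hlim : Tendsto (fun s => ∫ u, R s u) atTop (𝓝 0) := by
    have := tendsto_integral_filter_of_dominated_convergence (μ := (volume : Measure I))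
      (l := (atTop : Filter (Finset ι))) (F := R) (f := fun _ => 0) (fun _ => C ^ 2)
      (Eventually.of_forall fun s => (hRm s).aestronglyMeasurable)
      (Eventually.of_forall fun s => Eventually.of_forall (hRb s)) (integrable_const _)
      (Eventually.of_forall fun u => by
        have h := b.hasSum_repr (K u)
        simp_rw [b.repr_apply_apply] at h
        have h' : Tendsto (fun s => P s (K u)) atTop (𝓝 (K u)) := by
          simp_rw [hP]; exact h
        have h2 := ((tendsto_const_nhds (x := K u)).sub h').norm.pow 2
        simp_rw [hR] at h2
        simpa using h2)
    simpa using this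
  have hbound : ∀ s, ‖W.op - W.op ∘L P s‖ ≤ √(∫ u, R s u) := by
    intro s
    refine ContinuousLinearMap.opNorm_le_bound _ (Real.sqrt_nonneg _) fun f => ?_
    have hsym : ∀ k : L2I, inner ℝ k (P s f) = inner ℝ (P s k) f := by
      intro k
      rw [hP, hP, inner_sum, sum_inner]
      refine Finset.sum_congr rfl fun i _ => ?_
      rw [inner_smul_right, inner_smul_left, real_inner_comm (b i) k]
      simp only [conj_trivial]; ring
    have hsq : ‖(W.op - W.op ∘L P s) f‖ ^ 2 ≤ ∫ u, R s u * ‖f‖ ^ 2 := by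
      rw [← real_inner_self_eq_norm_sq, L2.inner_def]
      refine integral_mono_of_nonneg (Eventually.of_forall fun u => real_inner_self_nonneg)
        ((hRi s).mul_const _) ?_
      have h1 : (W.op - W.op ∘L P s) f = W.op f - W.op (P s f) := rfl
      rw [h1]
      filter_upwards [Lp.coeFn_sub (W.op f) (W.op (P s f)), W.op_coeFn f, W.op_coeFn (P s f)]
        with u h2 h3 h4
      rw [real_inner_self_eq_norm_sq, h2, Pi.sub_apply, h3, h4, opFun_eq_inner, opFun_eq_inner,
        hsym, ← inner_sub_left, ← hR s u, ← mul_pow]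
      gcongr
      exact abs_real_inner_le_norm _ _
    rw [integral_mul_const] at hsq
    rw [← Real.sqrt_sq (norm_nonneg f), ← Real.sqrt_mul' _ (sq_nonneg _)]
    exact Real.le_sqrt_of_sq_le hsq
  have ht : Tendsto (fun s => W.op ∘L P s) atTop (𝓝 W.op) := by
    rw [tendsto_iff_norm_sub_tendsto_zero]
    refine squeeze_zero (fun _ => norm_nonneg _)
      (fun s => (norm_sub_rev _ _).trans_le (hbound s)) ?_
    simpa using hlim.sqrt
  refine isCompactOperator_of_tendsto ht (Eventually.of_forall fun s => ?_)
  refine IsCompactOperator.clm_comp (f := P s) ?_ W.op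
  have : ∀ s, IsCompactOperator (P s) := by
    classical
    intro s
    induction s using Finset.induction_on with
    | empty => simpa [P] using! isCompactOperator_zero
    | insert a s ha ih =>
      have : P (insert a s) = (innerSL ℝ (b a)).smulRight (b a) + P s := by
        simp [P, Finset.sum_insert ha]
      rw [this]
      refine IsCompactOperator.add ?_ ih
      have hc : IsCompactOperator (innerSL ℝ (b a) : L2I →L[ℝ] ℝ) :=
        isCompactOperator_of_locallyCompactSpace_dom (innerSL ℝ (b a))
      exact hc.clm_comp (ContinuousLinearMap.toSpanSingleton ℝ (b a))
  exact this s

/-- Spectral theorem: `T_W` has a complete orthonormal system of eigenfunctions. -/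
theorem exists_eigenbasis : ∃ ι : Type, Nonempty (W.Eigenbasis ι) := by
  obtain ⟨ι, B, μ, h⟩ := exists_hilbertBasis_eigenvectors W.op W.op_isCompact W.op_isSymmetric
  exact ⟨ι, ⟨⟨B, μ, h⟩⟩⟩

end Graphon

/-! ### Convergence -/

/-- The graphs converge to the graphon: the density of every motif converges. -/
def GraphsConverge {N : ℕ → ℕ} (G : ∀ n, WGraph (N n)) (W : Graphon) : Prop :=
  ∀ (k : ℕ) (F : SimpleGraph (Fin k)),
    Tendsto (fun n => (G n).homDensity F) atTop (𝓝 (W.homDensity F))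

/-- The graph signals `(G n, x n)` converge to the graphon signal `(W, φ)`: the graphs converge,
and there are relabellings of their nodes under which the induced graphons converge to `W` in cut
norm and the induced signals converge to `φ` in `L²`. -/
def GraphSignalsConverge {N : ℕ → ℕ} (G : ∀ n, WGraph (N n)) (x : ∀ n, Fin (N n) → ℝ)
    (W : Graphon) (φ : L2I) : Prop :=
  GraphsConverge G W ∧
  ∃ π : ∀ n, Equiv.Perm (Fin (N n)),
    Tendsto (fun n => cutNorm (fun u v => ((G n).permute (π n)).induced u v - W u v))
      atTop (𝓝 0) ∧
    Tendsto (fun n => inducedSignal (x n ∘ π n)) atTop (𝓝 φ)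

end

/-!
Signals on a graph with `n` nodes embed into `L²([0,1])` as step functions. The embedding preserves
norms up to the factor `√n`, and it intertwines the scaled shift operator `S / n` with the integral
operator of the induced graphon (`WGraph.op_signalEmbedding`). Graph filters with polynomial filter
function are therefore polynomials of this integral operator
(`WGraph.signalEmbedding_filter_eval`), and they are insensitive to the choice of eigenvectors and
to the labelling of the nodes.

For uniformly bounded kernels, convergence in cut norm makes the integral operators converge
strongly (`Graphon.tendsto_op_apply`): on the indicator of a set `B`, the difference kernel `K`
satisfies `‖T_K 1_B‖² ≤ sup |K| * ‖T_K 1_B‖₁ ≤ sup |K| * 2 ‖K‖_cut`, and the operators are uniformly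
bounded, so a density argument suffices. Polynomials of these operators then converge strongly as
well (`Graphon.tendsto_aeval_op`).

The spectra of all the `S / n` and of the limit operator lie in `[-M, M]`, where `h` is a uniform
limit of polynomials `p` by the Weierstrass theorem. If `|h - p| ≤ ε` on `[-M, M]`, replacing `h` by
`p` changes the output of a filter by at most `ε` times the norm of its input, both for graphs
(`WGraph.norm_signalEmbedding_filter_le`) and for the graphon
(`Graphon.Eigenbasis.summable_filterTerm_and_norm_filter_le`).
-/

/-! ### Step signals -/

lemma cell_unique {n : ℕ} {j k : Fin n} {u : I} (hj : u ∈ cell n j) (hk : u ∈ cell n k) :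
    j = k := by
  have hn : (0 : ℝ) < n := by exact_mod_cast j.pos
  have key : ∀ {j k : Fin n}, u ∈ cell n j → u ∈ cell n k → (k : ℕ) ≤ j := by
    rintro j k ⟨-, h | h⟩ ⟨h', -⟩
    · have h2 := h'.trans_lt h
      rw [div_lt_div_iff_of_pos_right hn] at h2
      have h3 : (k : ℕ) < (j : ℕ) + 1 := by exact_mod_cast h2
      omega
    · omega
  exact Fin.ext (le_antisymm (key hk hj) (key hj hk))

lemma volume_real_cell {n : ℕ} (k : Fin n) : (volume : Measure I).real (cell n k) = 1 / n := by
  have hn : (0 : ℝ) < n := by exact_mod_cast k.pos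
  have hk : ((k : ℕ) : ℝ) + 1 ≤ n := by exact_mod_cast k.isLt
  have hk1 : ((k : ℝ) + 1) / n ≤ 1 := (div_le_one hn).2 hk
  have hk0 : (0 : ℝ) ≤ (k : ℝ) / n := by positivity
  have hkk : (k : ℝ) / n ≤ ((k : ℝ) + 1) / n := by gcongr; linarith
  have hd : ((k : ℝ) + 1) / n - (k : ℝ) / n = 1 / n := by ring
  let a : I := ⟨(k : ℝ) / n, hk0, hkk.trans hk1⟩
  let b : I := ⟨((k : ℝ) + 1) / n, hk0.trans hkk, hk1⟩
  have h1 : Set.Ico a b ⊆ cell n k := fun u hu => ⟨hu.1, Or.inl hu.2⟩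
  have h2 : cell n k ⊆ Set.Icc a b := by
    rintro u ⟨hu, hu' | hu'⟩
    · exact ⟨hu, hu'.le⟩
    · refine ⟨hu, ?_⟩
      have : (b : ℝ) = 1 := by
        simp only [b]
        rw [div_eq_one_iff_eq hn.ne']
        exact_mod_cast hu'
      exact Subtype.coe_le_coe.1 (this ▸ u.2.2)
  have h3 : volume (cell n k) = ENNReal.ofReal (1 / n) := by
    refine le_antisymm ((measure_mono h2).trans ?_) (le_trans ?_ (measure_mono h1))
    · rw [unitInterval.volume_Icc, ← hd]
    · rw [unitInterval.volume_Ico, ← hd]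
  rw [Measure.real, h3, ENNReal.toReal_ofReal (by positivity)]

lemma stepSignal_of_mem {n : ℕ} (x : Fin n → ℝ) {k : Fin n} {u : I} (hu : u ∈ cell n k) :
    stepSignal x u = x k := by
  unfold stepSignal
  rw [Finset.sum_eq_single k]
  · simp [hu]
  · intro j _ hj
    rw [Set.indicator_of_notMem fun h => hj (cell_unique h hu), mul_zero]
  · simp

lemma stepSignal_of_forall_notMem {n : ℕ} (x : Fin n → ℝ) {u : I} (hu : ∀ k, u ∉ cell n k) :
    stepSignal x u = 0 :=
  Finset.sum_eq_zero fun k _ => by rw [Set.indicator_of_notMem (hu k), mul_zero]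

lemma stepSignal_mul {n : ℕ} (x y : Fin n → ℝ) (u : I) :
    stepSignal x u * stepSignal y u = stepSignal (fun k => x k * y k) u := by
  by_cases hu : ∃ k, u ∈ cell n k
  · obtain ⟨k, hk⟩ := hu
    simp only [stepSignal_of_mem _ hk]
  · push Not at hu
    simp [stepSignal_of_forall_notMem _ hu]

lemma abs_stepSignal_le {n : ℕ} {x : Fin n → ℝ} {C : ℝ} (hC : 0 ≤ C) (hx : ∀ k, |x k| ≤ C)
    (u : I) : |stepSignal x u| ≤ C := by
  by_cases hu : ∃ k, u ∈ cell n k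
  · obtain ⟨k, hk⟩ := hu
    rw [stepSignal_of_mem _ hk]
    exact hx k
  · push Not at hu
    simpa [stepSignal_of_forall_notMem _ hu]

lemma integral_stepSignal {n : ℕ} (x : Fin n → ℝ) :
    ∫ u, stepSignal x u = (∑ k, x k) / n := by
  unfold stepSignal
  rw [integral_finsetSum, Finset.sum_div]
  · refine Finset.sum_congr rfl fun k _ => ?_
    rw [integral_const_mul, integral_indicator_one (measurableSet_cell n k), volume_real_cell]
    ring
  · exact fun k _ => ((integrable_const (1 : ℝ)).indicator (measurableSet_cell n k)).const_mul _

/-- The isometry, up to the factor `√n`, that turns a signal on `n` nodes, relabelled by `π`,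
into a function on `[0,1]`. -/
noncomputable def signalEmbedding {n : ℕ} (π : Equiv.Perm (Fin n)) : (Fin n → ℝ) →ₗ[ℝ] L2I where
  toFun x := inducedSignal (x ∘ π)
  map_add' x y := by
    unfold inducedSignal
    rw [← MemLp.toLp_add]
    refine MemLp.toLp_congr _ _ (Eventually.of_forall fun u => ?_)
    simp [stepSignal, add_mul, Finset.sum_add_distrib]
  map_smul' c x := by
    unfold inducedSignal
    rw [RingHom.id_apply, ← MemLp.toLp_const_smul]
    refine MemLp.toLp_congr _ _ (Eventually.of_forall fun u => ?_)
    simp [stepSignal, mul_assoc, Finset.mul_sum]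

lemma signalEmbedding_coeFn {n : ℕ} (π : Equiv.Perm (Fin n)) (x : Fin n → ℝ) :
    signalEmbedding π x =ᵐ[volume] stepSignal (x ∘ π) := (memLp_stepSignal _).coeFn_toLp

lemma norm_signalEmbedding_sq {n : ℕ} (π : Equiv.Perm (Fin n)) (x : Fin n → ℝ) :
    ‖signalEmbedding π x‖ ^ 2 = (x ⬝ᵥ x) / n := by
  have h : ‖signalEmbedding π x‖ ^ 2 = ∫ u, stepSignal (fun k => x (π k) * x (π k)) u := by
    rw [← real_inner_self_eq_norm_sq, L2.inner_def]
    refine integral_congr_ae ?_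
    filter_upwards [signalEmbedding_coeFn π x] with u hu
    simp only [hu, RCLike.inner_apply, conj_trivial]
    exact stepSignal_mul _ _ u
  rw [h, integral_stepSignal, Equiv.sum_comp π fun k => x k * x k]
  rfl

/-! ### The integral operator of a graph -/

lemma WGraph.induced_apply {n : ℕ} (G : WGraph n) (u v : I) :
    G.induced u v = stepSignal (fun j => stepSignal (G.shift j) v) u := by
  simp only [WGraph.induced, stepSignal, Finset.sum_mul]
  refine Finset.sum_congr rfl fun j _ => Finset.sum_congr rfl fun k _ => by ring

lemma WGraph.abs_induced_le {n : ℕ} (G : WGraph n) {M : ℝ} (hM : 0 ≤ M)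
    (hG : ∀ i j, |G.shift i j| ≤ M) (u v : I) : |G.induced u v| ≤ M := by
  rw [induced_apply]
  exact abs_stepSignal_le hM (fun j => abs_stepSignal_le hM (hG j) v) u

/-- The signal embedding intertwines the scaled shift operator of a graph with the integral
operator of the induced graphon. -/
lemma WGraph.op_signalEmbedding {n : ℕ} (G : WGraph n) (π : Equiv.Perm (Fin n))
    (x : Fin n → ℝ) :
    (G.permute π).induced.op (signalEmbedding π x)
      = signalEmbedding π (((n : ℝ)⁻¹ • G.shift) *ᵥ x) := by
  refine Lp.ext ?_
  filter_upwards [(G.permute π).induced.op_coeFn (signalEmbedding π x),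
    signalEmbedding_coeFn π (((n : ℝ)⁻¹ • G.shift) *ᵥ x)] with u h1 h2
  rw [h1, h2]
  have h3 : (G.permute π).induced.opFun (signalEmbedding π x) u
      = ∫ v, (G.permute π).induced u v * stepSignal (x ∘ π) v := by
    refine integral_congr_ae ?_
    filter_upwards [signalEmbedding_coeFn π x] with v hv
    rw [hv]
  rw [h3]
  simp only [induced_apply]
  by_cases hu : ∃ k, u ∈ cell n k
  · obtain ⟨k, hk⟩ := hu
    simp only [stepSignal_of_mem _ hk, stepSignal_mul, integral_stepSignal]
    have h4 : ∑ l, (G.permute π).shift k l * (x ∘ π) l = ∑ l, G.shift (π k) l * x l :=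
      Equiv.sum_comp π fun l => G.shift (π k) l * x l
    rw [h4, smul_mulVec, Function.comp_apply, Pi.smul_apply, smul_eq_mul, div_eq_inv_mul]
    rfl
  · push Not at hu
    simp [stepSignal_of_forall_notMem _ hu]

lemma Graphon.norm_op_apply_le (W : Graphon) {C : ℝ} (hC : ∀ u v, |W u v| ≤ C) (f : L2I) :
    ‖W.op f‖ ≤ C * ‖f‖ := by
  have h0 : 0 ≤ C := (abs_nonneg _).trans (hC 0 0)
  have := Lp.norm_le_of_ae_bound (p := 2) (μ := (volume : Measure I))
    (f := W.op f) (mul_nonneg h0 (norm_nonneg f)) (by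
      filter_upwards [W.op_coeFn f] with v hv
      rw [hv]
      exact W.abs_opFun_le hC f v)
  simpa [measureUnivNNReal] using this

/-! ### Graph filters -/

namespace WGraph

variable {n : ℕ} (G : WGraph n)

/-- `V` preserves the Euclidean norm, so a filter function bounded by `ε` on the spectrum yields a
filter of norm at most `ε`. -/
lemma norm_signalEmbedding_filter_le (π : Equiv.Perm (Fin n)) {g : ℝ → ℝ} {ε : ℝ} (hε : 0 ≤ ε)
    (hg : ∀ j, |g (G.symm.eigenvalues j / n)| ≤ ε) (x : Fin n → ℝ) :
    ‖signalEmbedding π (G.filter g *ᵥ x)‖ ≤ ε * ‖signalEmbedding π x‖ := by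
  set V := (G.symm.eigenvectorUnitary : Matrix (Fin n) (Fin n) ℝ) with hV
  have h1 : Vᵀ * V = 1 := by
    simpa [star_eq_conjTranspose] using Unitary.coe_star_mul_self G.symm.eigenvectorUnitary
  have h2 : V * Vᵀ = 1 := by
    simpa [star_eq_conjTranspose] using Unitary.coe_mul_star_self G.symm.eigenvectorUnitary
  have iso : ∀ A : Matrix (Fin n) (Fin n) ℝ, Aᵀ * A = 1 → ∀ y, (A *ᵥ y) ⬝ᵥ (A *ᵥ y) = y ⬝ᵥ y := by
    intro A hA y
    rw [dotProduct_mulVec, vecMul_mulVec, hA, vecMul_one]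
  -- the spectral coefficients of `x`
  set y := Vᵀ *ᵥ x with hy
  have hyx : y ⬝ᵥ y = x ⬝ᵥ x := iso _ (by rwa [transpose_transpose]) x
  have hfx : (G.filter g *ᵥ x) ⬝ᵥ (G.filter g *ᵥ x)
      = ∑ j, (g (G.symm.eigenvalues j / n) * y j) ^ 2 := by
    unfold filter
    rw [← hV, conjTranspose_eq_transpose_of_trivial, ← mulVec_mulVec, ← mulVec_mulVec, iso V h1]
    simp [dotProduct, mulVec_diagonal, hy, sq]
  refine le_of_sq_le_sq ?_ (by positivity)
  rw [mul_pow, norm_signalEmbedding_sq, norm_signalEmbedding_sq, hfx, ← mul_div_assoc, ← hyx,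
    dotProduct, Finset.mul_sum]
  gcongr with j
  rw [mul_pow, ← sq]
  exact mul_le_mul_of_nonneg_right (sq_le_sq' (abs_le.1 (hg j)).1 (abs_le.1 (hg j)).2)
    (sq_nonneg _)

lemma filter_sub (f g : ℝ → ℝ) :
    G.filter (fun t => f t - g t) = G.filter f - G.filter g := by
  unfold filter
  rw [← sub_mul, ← mul_sub, diagonal_sub]

lemma filter_eval (p : Polynomial ℝ) :
    G.filter (fun t => p.eval t) = Polynomial.aeval ((n : ℝ)⁻¹ • G.shift) p := by
  have h1 : (n : ℝ)⁻¹ • G.shift = Unitary.conjStarAlgAut ℝ _ G.symm.eigenvectorUnitary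
      (Matrix.diagonalAlgHom ℝ fun j => G.symm.eigenvalues j / n) := by
    conv_lhs => rw [G.symm.spectral_theorem, ← map_smul]
    congr 1
    ext i j
    simp [diagonal_apply, div_eq_inv_mul]
  rw [h1]
  have h2 := Polynomial.aeval_algHom_apply
    (Unitary.conjStarAlgAut ℝ _ G.symm.eigenvectorUnitary).toAlgEquiv.toAlgHom
    (Matrix.diagonalAlgHom ℝ fun j => G.symm.eigenvalues j / n) p
  refine Eq.trans ?_ h2.symm
  rw [Polynomial.aeval_algHom_apply, Polynomial.aeval_pi_apply]
  simp [filter, Unitary.conjStarAlgAut_apply, star_eq_conjTranspose]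

lemma signalEmbedding_filter_eval (π : Equiv.Perm (Fin n)) (p : Polynomial ℝ) (x : Fin n → ℝ) :
    signalEmbedding π (G.filter (fun t => p.eval t) *ᵥ x)
      = Polynomial.aeval (G.permute π).induced.op p (signalEmbedding π x) := by
  rw [filter_eval]
  induction p using Polynomial.induction_on' with
  | add p q hp hq => simp [add_mulVec, hp, hq]
  | monomial k a =>
    rw [Polynomial.aeval_monomial, Polynomial.aeval_monomial]
    induction k generalizing x with
    | zero => simp [Algebra.algebraMap_eq_smul_one, smul_mulVec]
    | succ k ih =>
      rw [pow_succ, ← mul_assoc, ← mulVec_mulVec, ih, pow_succ, ← mul_assoc,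
        mul_apply_eq_comp _ (G.permute π).induced.op, op_signalEmbedding]

/-- The eigenvalues of `S / n` are eigenvalues of the integral operator of the induced graphon, whose
norm is at most `M`. -/
lemma abs_eigenvalues_div_le {M : ℝ} (hM : 0 ≤ M) (hG : ∀ i j, |G.shift i j| ≤ M) (j : Fin n) :
    |G.symm.eigenvalues j / n| ≤ M := by
  have hn : (0 : ℝ) < n := by exact_mod_cast j.pos
  set v : Fin n → ℝ := ⇑(G.symm.eigenvectorBasis j) with hv
  have hSv : ((n : ℝ)⁻¹ • G.shift) *ᵥ v = (G.symm.eigenvalues j / n) • v := by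
    rw [smul_mulVec, hv, G.symm.mulVec_eigenvectorBasis j, smul_smul, div_eq_inv_mul]
  have hvv : v ⬝ᵥ v = 1 := by
    have h := G.symm.eigenvectorBasis.orthonormal.1 j
    have h' := EuclideanSpace.real_norm_sq_eq (G.symm.eigenvectorBasis j)
    rw [h] at h'
    simpa [dotProduct, sq, hv] using h'.symm
  have hpos : 0 < ‖signalEmbedding 1 v‖ := by
    refine (norm_nonneg _).lt_of_ne' fun h0 => ?_
    have := norm_signalEmbedding_sq 1 v
    rw [h0, hvv] at this
    rw [zero_pow two_ne_zero] at this
    exact (one_div_pos.2 hn).ne this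
  have h := Graphon.norm_op_apply_le (G.permute 1).induced
    ((G.permute 1).abs_induced_le hM fun i j => hG _ _) (signalEmbedding 1 v)
  rw [op_signalEmbedding, hSv, map_smul, norm_smul, Real.norm_eq_abs] at h
  exact le_of_mul_le_mul_right h hpos

end WGraph

/-! ### Cut norm and strong convergence of integral operators -/

lemma abs_setIntegral_le {g : I → ℝ} {C : ℝ} (hg : ∀ v, |g v| ≤ C) (S : Set I) :
    |∫ v in S, g v| ≤ C := by
  rw [← Real.norm_eq_abs]
  exact (norm_setIntegral_le_of_norm_le_const (measure_lt_top _ _) fun v _ => hg v).trans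
    (mul_le_of_le_one_right ((abs_nonneg _).trans (hg 0)) measureReal_le_one)

lemma abs_setIntegral_le_cutNorm {K : I → I → ℝ} {C : ℝ} (hC : ∀ u v, |K u v| ≤ C)
    {A B : Set I} (hA : MeasurableSet A) (hB : MeasurableSet B) :
    |∫ u in A, ∫ v in B, K u v| ≤ cutNorm K := by
  refine le_ciSup (f := fun p : {A : Set I // MeasurableSet A} × {B : Set I // MeasurableSet B} =>
    |∫ u in p.1.1, ∫ v in p.2.1, K u v|) ⟨C, ?_⟩ (⟨A, hA⟩, ⟨B, hB⟩)
  rintro _ ⟨p, rfl⟩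
  exact abs_setIntegral_le (fun u => abs_setIntegral_le (hC u) _) _

lemma integral_abs_setIntegral_le {K : I → I → ℝ} (hK : Measurable (Function.uncurry K)) {C : ℝ}
    (hC : ∀ u v, |K u v| ≤ C) {B : Set I} (hB : MeasurableSet B) :
    ∫ u, |∫ v in B, K u v| ≤ 2 * cutNorm K := by
  set g : I → ℝ := fun u => ∫ v in B, K u v with hg
  have hgm : StronglyMeasurable g :=
    (hK.stronglyMeasurable : StronglyMeasurable (Function.uncurry K)).integral_prod_right
  have hgb : ∀ u, |g u| ≤ C := fun u => abs_setIntegral_le (hC u) B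
  have hgi : Integrable g :=
    (integrable_const C).mono' hgm.aestronglyMeasurable (Eventually.of_forall hgb)
  -- split according to the sign of the inner integral
  have hA : MeasurableSet {u | 0 ≤ g u} := measurableSet_le measurable_const hgm.measurable
  rw [← integral_add_compl hA hgi.abs]
  have e1 : ∫ u in {u | 0 ≤ g u}, |g u| = ∫ u in {u | 0 ≤ g u}, g u :=
    setIntegral_congr_fun hA fun u hu => abs_of_nonneg hu
  have e2 : ∫ u in {u | 0 ≤ g u}ᶜ, |g u| = -∫ u in {u | 0 ≤ g u}ᶜ, g u := by
    rw [← integral_neg]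
    exact setIntegral_congr_fun hA.compl fun u hu => abs_of_neg (not_le.1 hu)
  rw [e1, e2]
  have i1 := abs_le.1 (abs_setIntegral_le_cutNorm hC hA hB)
  have i2 := abs_le.1 (abs_setIntegral_le_cutNorm hC hA.compl hB)
  simp only [hg] at i1 i2 ⊢
  linarith [i1.2, i2.1]

namespace Graphon

lemma opFun_indicatorConstLp (W : Graphon) {B : Set I} (hB : MeasurableSet B) (c : ℝ) (u : I) :
    W.opFun (indicatorConstLp 2 hB (measure_ne_top _ _) c) u = c * ∫ v in B, W u v := by
  rw [← integral_const_mul, ← integral_indicator hB]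
  refine integral_congr_ae ?_
  filter_upwards [indicatorConstLp_coeFn (p := 2) (hs := hB) (hμs := measure_ne_top volume B)
    (c := c)] with v hv
  rw [hv]
  by_cases hvB : v ∈ B <;> simp [hvB, mul_comm]

/-- On the indicator of a set the squared `L²` distance of two integral operators is controlled by
the cut norm, because the kernels are bounded: `∫ g² ≤ sup |g| · ∫ |g|`. -/
lemma norm_op_sub_indicatorConstLp_sq_le (U W : Graphon) {C : ℝ}
    (hC : ∀ u v, |U u v - W u v| ≤ C) {B : Set I} (hB : MeasurableSet B) (c : ℝ) :
    ‖U.op (indicatorConstLp 2 hB (measure_ne_top _ _) c)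
        - W.op (indicatorConstLp 2 hB (measure_ne_top _ _) c)‖ ^ 2
      ≤ c ^ 2 * (C * (2 * cutNorm fun u v => U u v - W u v)) := by
  have h0 : 0 ≤ C := (abs_nonneg _).trans (hC 0 0)
  have hK : Measurable (Function.uncurry fun u v => U u v - W u v) :=
    U.measurable'.sub W.measurable'
  set g : I → ℝ := fun u => ∫ v in B, (U u v - W u v) with hg
  have hgm : StronglyMeasurable g :=
    (hK.stronglyMeasurable : StronglyMeasurable
      (Function.uncurry fun u v => U u v - W u v)).integral_prod_right
  have hgb : ∀ u, |g u| ≤ C := fun u => abs_setIntegral_le (hC u) B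
  have hgi : Integrable g :=
    (integrable_const C).mono' hgm.aestronglyMeasurable (Eventually.of_forall hgb)
  have hint : ∀ (V : Graphon) u, IntegrableOn (V u) B := fun V u =>
    ((V.memLp_section u).integrable (by norm_num)).integrableOn
  set f : L2I := indicatorConstLp 2 hB (measure_ne_top _ _) c with hf
  have h1 : ‖U.op f - W.op f‖ ^ 2 = ∫ u, c ^ 2 * (g u) ^ 2 := by
    rw [← real_inner_self_eq_norm_sq, L2.inner_def]
    refine integral_congr_ae ?_
    filter_upwards [Lp.coeFn_sub (U.op f) (W.op f), U.op_coeFn f, W.op_coeFn f] with u e1 e2 e3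
    rw [real_inner_self_eq_norm_sq, e1, Pi.sub_apply, e2, e3, hf, opFun_indicatorConstLp,
      opFun_indicatorConstLp, ← mul_sub, ← integral_sub (hint U u) (hint W u), Real.norm_eq_abs,
      sq_abs, mul_pow]
  rw [h1, integral_const_mul]
  gcongr
  calc ∫ u, (g u) ^ 2 ≤ ∫ u, C * |g u| := by
        refine integral_mono_of_nonneg (Eventually.of_forall fun u => sq_nonneg _)
          (hgi.abs.const_mul C) (Eventually.of_forall fun u => ?_)
        simp only
        rw [← sq_abs, sq]
        gcongr
        exact hgb u
    _ = C * ∫ u, |g u| := integral_const_mul _ _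
    _ ≤ _ := by
        gcongr
        exact integral_abs_setIntegral_le hK hC hB

/-- For uniformly bounded graphons, convergence in cut norm implies strong convergence of the
integral operators. -/
lemma tendsto_op_apply {U : ℕ → Graphon} {W : Graphon} {C : ℝ} (hU : ∀ n u v, |U n u v| ≤ C)
    (h : Tendsto (fun n => cutNorm fun u v => U n u v - W u v) atTop (𝓝 0)) (f : L2I) :
    Tendsto (fun n => (U n).op f) atTop (𝓝 (W.op f)) := by
  obtain ⟨D, hD⟩ := W.bounded'
  have hCD : ∀ n u v, |U n u v - W u v| ≤ C + D := fun n u v =>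
    (abs_sub _ _).trans (add_le_add (hU n u v) (hD u v))
  have hnorm : ∀ n, ‖(U n).op - W.op‖ ≤ C + D := by
    intro n
    refine ContinuousLinearMap.opNorm_le_bound _ ((abs_nonneg _).trans (hCD n 0 0)) fun f => ?_
    refine (norm_sub_le _ _).trans ?_
    rw [add_mul]
    exact add_le_add ((U n).norm_op_apply_le (hU n) f) (W.norm_op_apply_le hD f)
  have hCD0 : 0 ≤ C + D := (norm_nonneg _).trans (hnorm 0)
  have hmain : ∀ f : L2I, Tendsto (fun n => ‖((U n).op - W.op) f‖) atTop (𝓝 0) := by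
    refine Lp.induction (by norm_num) _ ?_ ?_ ?_
    · intro c B hB _
      have h1 : Tendsto (fun n => √(c ^ 2 * ((C + D) * (2 * cutNorm fun u v => U n u v - W u v))))
          atTop (𝓝 0) := by
        simpa using (((h.const_mul 2).const_mul (C + D)).const_mul (c ^ 2)).sqrt
      refine squeeze_zero (fun _ => norm_nonneg _) (fun n => ?_) h1
      exact Real.le_sqrt_of_sq_le (norm_op_sub_indicatorConstLp_sq_le (U n) W (hCD n) hB c)
    · intro f g hf hg _ h1 h2
      refine squeeze_zero (fun _ => norm_nonneg _) (fun n => ?_) (by simpa using h1.add h2)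
      rw [map_add]
      exact norm_add_le _ _
    · -- the limit passes to the closure by equicontinuity
      refine isClosed_of_closure_subset fun f hf => ?_
      rw [Set.mem_ofPred_eq, Metric.tendsto_atTop']
      intro ε hε
      obtain ⟨g, hg, hfg⟩ := Metric.mem_closure_iff.1 hf (ε / (2 * (C + D + 1))) (by positivity)
      obtain ⟨n₀, hn₀⟩ := Metric.tendsto_atTop'.1 hg (ε / 2) (by positivity)
      refine ⟨n₀, fun n hn => ?_⟩
      have h1 := hn₀ n hn
      rw [dist_zero_right, norm_norm] at h1 ⊢
      have h2 : ‖((U n).op - W.op) (f - g)‖ ≤ ε / 2 := by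
        refine (((U n).op - W.op).le_of_opNorm_le (hnorm n) _).trans ?_
        rw [← dist_eq_norm]
        calc (C + D) * dist f g ≤ (C + D + 1) * (ε / (2 * (C + D + 1))) :=
              mul_le_mul (by linarith) hfg.le dist_nonneg (by linarith)
          _ = ε / 2 := by field_simp
      have h3 : ((U n).op - W.op) f = ((U n).op - W.op) (f - g) + ((U n).op - W.op) g := by
        rw [← map_add, sub_add_cancel]
      rw [h3]
      exact (norm_add_le _ _).trans_lt (by linarith)
  rw [tendsto_iff_norm_sub_tendsto_zero]
  exact hmain f

/-- Polynomials of strongly convergent integral operators converge strongly, also along a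
convergent sequence of arguments. -/
lemma tendsto_aeval_op {U : ℕ → Graphon} {W : Graphon} {C : ℝ} (hU : ∀ n u v, |U n u v| ≤ C)
    (h : Tendsto (fun n => cutNorm fun u v => U n u v - W u v) atTop (𝓝 0)) {f : ℕ → L2I} {g : L2I}
    (hf : Tendsto f atTop (𝓝 g)) (p : Polynomial ℝ) :
    Tendsto (fun n => Polynomial.aeval (U n).op p (f n)) atTop
      (𝓝 (Polynomial.aeval W.op p g)) := by
  have hstep : ∀ {f : ℕ → L2I} {g : L2I}, Tendsto f atTop (𝓝 g) →
      Tendsto (fun n => (U n).op (f n)) atTop (𝓝 (W.op g)) := by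
    intro f g hf
    have h1 : Tendsto (fun n => (U n).op (f n - g)) atTop (𝓝 0) := by
      refine squeeze_zero_norm (fun n => (U n).norm_op_apply_le (hU n) _) ?_
      simpa using (tendsto_iff_norm_sub_tendsto_zero.1 hf).const_mul C
    simpa using h1.add (tendsto_op_apply hU h g)
  induction p using Polynomial.induction_on' with
  | add p q hp hq => simpa using hp.add hq
  | monomial k a =>
    simp only [Polynomial.aeval_monomial]
    induction k generalizing f g with
    | zero => simpa [Algebra.algebraMap_eq_smul_one] using hf.const_smul a
    | succ k ih =>
      simp only [pow_succ, ← mul_assoc]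
      exact ih (hstep hf)

/-- The bound on the limit operator needs no pointwise bound on the limit graphon, which the cut
norm determines only almost everywhere. -/
lemma norm_op_apply_le_of_tendsto {U : ℕ → Graphon} {W : Graphon} {C : ℝ}
    (hU : ∀ n u v, |U n u v| ≤ C)
    (h : Tendsto (fun n => cutNorm fun u v => U n u v - W u v) atTop (𝓝 0)) (f : L2I) :
    ‖W.op f‖ ≤ C * ‖f‖ :=
  le_of_tendsto (tendsto_op_apply hU h f).norm
    (Eventually.of_forall fun n => (U n).norm_op_apply_le (hU n) f)

/-! ### Graphon filters -/

namespace Eigenbasis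

variable {W : Graphon} {ι : Type*} (E : W.Eigenbasis ι)

lemma wft_eq_inner (φ : L2I) (i : ι) : E.wft φ i = inner ℝ (E.basis i) φ := by
  simp [wft, L2.inner_def]

lemma abs_eigenvalue_le {M : ℝ} (hM : ∀ f, ‖W.op f‖ ≤ M * ‖f‖) (i : ι) :
    |E.eigenvalue i| ≤ M := by
  have := hM (E.basis i)
  rwa [E.op_basis, norm_smul, E.basis.orthonormal.1, mul_one, mul_one] at this

/-- By Parseval, a filter function bounded by `B` on the eigenvalues yields a filter of norm at most
`B`. -/
lemma summable_filterTerm_and_norm_filter_le {g : ℝ → ℝ} {B : ℝ} (hB : 0 ≤ B)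
    (hg : ∀ i, |g (E.eigenvalue i)| ≤ B) (φ : L2I) :
    Summable (E.filterTerm g φ) ∧ ‖E.filter g φ‖ ≤ B * ‖φ‖ := by
  have hle : ∀ i, ‖g (E.eigenvalue i) * E.wft φ i‖ ≤ ‖(B • E.basis.repr φ) i‖ := by
    intro i
    rw [lp.coeFn_smul, Pi.smul_apply, smul_eq_mul, E.basis.repr_apply_apply, ← wft_eq_inner,
      norm_mul, norm_mul, Real.norm_of_nonneg hB]
    gcongr
    exact hg i
  have hmem : Memℓp (fun i => g (E.eigenvalue i) * E.wft φ i) 2 :=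
    (lp.memℓp (B • E.basis.repr φ)).mono' hle
  have hs := E.basis.hasSum_repr_symm ⟨_, hmem⟩
  refine ⟨hs.summable, ?_⟩
  have : E.filter g φ = E.basis.repr.symm ⟨_, hmem⟩ := hs.tsum_eq
  rw [this, LinearIsometryEquiv.norm_map]
  calc _ ≤ ‖B • E.basis.repr φ‖ := lp.norm_mono (by norm_num) hle
    _ = B * ‖φ‖ := by rw [norm_smul, Real.norm_of_nonneg hB, LinearIsometryEquiv.norm_map]

lemma hasSum_filterTerm_eval (p : Polynomial ℝ) (φ : L2I) :
    HasSum (E.filterTerm (fun t => p.eval t) φ) (Polynomial.aeval W.op p φ) := by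
  have hp : ∀ i, Polynomial.aeval W.op p (E.basis i) = p.eval (E.eigenvalue i) • E.basis i := by
    intro i
    induction p using Polynomial.induction_on' with
    | add p q hp hq => simp [hp, hq, add_smul]
    | monomial k a =>
      rw [Polynomial.aeval_monomial, Polynomial.eval_monomial]
      induction k with
      | zero => simp [Algebra.algebraMap_eq_smul_one]
      | succ k ih =>
        rw [pow_succ, ← mul_assoc, mul_apply_eq_comp _ W.op, E.op_basis, map_smul, ih,
          smul_smul]
        congr 1
        ring
  have h := (E.basis.hasSum_repr φ).mapL (Polynomial.aeval W.op p)
  refine h.congr_fun ?_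
  intro i
  rw [map_smul, hp, smul_smul, E.basis.repr_apply_apply, ← wft_eq_inner, filterTerm, mul_comm]

end Eigenbasis

end Graphon

theorem mainTheorem2
    {N : ℕ → ℕ} (G : ∀ n, WGraph (N n)) (x : ∀ n, Fin (N n) → ℝ)
    (M : ℝ) (hM : ∀ n i j, |(G n).shift i j| ≤ M)
    (W : Graphon) (hW : W.NonDerogatory) {ι : Type*} (E : W.Eigenbasis ι) (φ : L2I)
    (hconv : GraphSignalsConverge G x W φ)
    (h : ℝ → ℝ) (L : ℝ≥0) (hL : LipschitzOnWith L h (Set.Icc (-M) M)) :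
    Summable (E.filterTerm h φ) ∧
      GraphSignalsConverge G (fun n => (G n).filter h *ᵥ x n) W (E.filter h φ) := by
  obtain ⟨hG, π, hcut, hsig⟩ := hconv
  -- The density of the one-vertex motif is `0` for the graph without nodes and `1` for `W`, so some
  -- graph has a node, and an entry of its shift operator shows `0 ≤ M`.
  have hM0 : 0 ≤ M := by
    by_contra hneg
    have hN : ∀ n, N n = 0 := by
      intro n
      by_contra hn
      let i : Fin (N n) := ⟨0, Nat.pos_of_ne_zero hn⟩
      exact hneg ((abs_nonneg _).trans (hM n i i))
    have h1 := hG 1 ⊥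
    have h2 : ∀ n, (G n).homDensity (⊥ : SimpleGraph (Fin 1)) = 0 := by
      intro n
      simp [WGraph.homDensity, hN n]
    have h3 : W.homDensity (⊥ : SimpleGraph (Fin 1)) = 1 := by
      simp [Graphon.homDensity]
    simp only [h2, h3] at h1
    exact zero_ne_one (tendsto_nhds_unique tendsto_const_nhds h1)
  have hU : ∀ n u v, |((G n).permute (π n)).induced u v| ≤ M := fun n =>
    ((G n).permute (π n)).abs_induced_le hM0 fun i j => hM n _ _
  have hspec : ∀ i, E.eigenvalue i ∈ Set.Icc (-M) M := fun i =>
    abs_le.1 (E.abs_eigenvalue_le (Graphon.norm_op_apply_le_of_tendsto hU hcut) i)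
  have hspecG : ∀ n j, (G n).symm.eigenvalues j / N n ∈ Set.Icc (-M) M := fun n j =>
    abs_le.1 ((G n).abs_eigenvalues_div_le hM0 (hM n) j)
  obtain ⟨B, hB⟩ := isCompact_Icc.exists_bound_of_continuousOn hL.continuousOn
  have hsum : Summable (E.filterTerm h φ) :=
    (E.summable_filterTerm_and_norm_filter_le (le_max_right B 0)
      (fun i => (hB _ (hspec i)).trans (le_max_left B 0)) φ).1
  refine ⟨hsum, hG, π, hcut, ?_⟩
  change Tendsto (fun n => signalEmbedding (π n) ((G n).filter h *ᵥ x n)) atTop _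
  change Tendsto (fun n => signalEmbedding (π n) (x n)) atTop _ at hsig
  rw [Metric.tendsto_atTop']
  intro δ hδ
  -- Replacing `h` by `p` costs at most `ε * ‖φ‖` in the limit and, since the norms of the embedded
  -- signals are eventually below `‖φ‖ + 1`, at most `ε * (‖φ‖ + 1) = δ / 3` along the sequence.
  have hpos : 0 < 3 * (‖φ‖ + 1) := by positivity
  obtain ⟨p, hp⟩ := exists_polynomial_near_of_continuousOn (-M) M h hL.continuousOn
    (δ / (3 * (‖φ‖ + 1))) (by positivity)
  set ε := δ / (3 * (‖φ‖ + 1)) with hε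
  have hε0 : 0 < ε := by positivity
  have hεφ : ε * (‖φ‖ + 1) = δ / 3 := by rw [hε]; field_simp
  have hp' : ∀ t ∈ Set.Icc (-M) M, |h t - p.eval t| ≤ ε := fun t ht => by
    rw [abs_sub_comm]
    exact (hp t ht).le
  have hpsum := E.hasSum_filterTerm_eval p φ
  have hlimit : ‖E.filter h φ - Polynomial.aeval W.op p φ‖ ≤ ε * ‖φ‖ := by
    have h1 := (E.summable_filterTerm_and_norm_filter_le (g := fun t => h t - p.eval t) hε0.le
      (fun i => hp' _ (hspec i)) φ).2
    have h2 : E.filter (fun t => h t - p.eval t) φ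
        = E.filter h φ - Polynomial.aeval W.op p φ := by
      rw [← hpsum.tsum_eq]
      unfold Graphon.Eigenbasis.filter
      rw [← hsum.tsum_sub hpsum.summable]
      exact tsum_congr fun i => by simp only [Graphon.Eigenbasis.filterTerm, sub_mul, sub_smul]
    rwa [h2] at h1
  have hpoly := Graphon.tendsto_aeval_op hU hcut hsig p
  have hnear := (Metric.tendsto_nhds.1 hpoly) (δ / 3) (by positivity)
  have hbdd := hsig.norm.eventually_lt_const (lt_add_one ‖φ‖)
  obtain ⟨n₀, hn₀⟩ := eventually_atTop.1 (hnear.and hbdd)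
  refine ⟨n₀, fun n hn => ?_⟩
  obtain ⟨hn1, hn2⟩ := hn₀ n hn.le
  have hgraph : ‖signalEmbedding (π n) ((G n).filter h *ᵥ x n)
      - Polynomial.aeval ((G n).permute (π n)).induced.op p (signalEmbedding (π n) (x n))‖
      ≤ δ / 3 := by
    rw [← WGraph.signalEmbedding_filter_eval, ← map_sub, ← sub_mulVec, ← WGraph.filter_sub]
    refine ((G n).norm_signalEmbedding_filter_le (π n) hε0.le
      (fun j => hp' _ (hspecG n j)) (x n)).trans ?_
    rw [← hεφ]
    gcongr
  rw [← dist_eq_norm] at hgraph hlimit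
  rw [dist_comm] at hlimit
  have := dist_triangle4 (signalEmbedding (π n) ((G n).filter h *ᵥ x n)) _ _ (E.filter h φ)
    |>.trans (add_le_add (add_le_add hgraph hn1.le) hlimit)
  nlinarith
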